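/- All Hilbert spaces are finite-dimensional. A quantum information structure $\rho_{AB}$ is a density matrix on $\mathcal H_A\otimes\mathcal H_B$. For a nonempty finite set $\mathcal X$ and self-adjoint operators $(O^i)_{i\in\mathcal X}$ on $\mathcal H_A$, put $$\$(\rho_{AB},O)=\max_{P}\sum_{i\in\mathcal X}\operatorname{Tr}[(O^i\otimes P^i)\rho_{AB}],$$ the maximum being over all POVMs $P=(P^i)_{i\in\mathcal X}$ on $\mathcal H_B$. Write $\rho_{AB}\supset_A\sigma_{AB'}$ (``$\rho_{AB}$ is more informative than $\sigma_{AB'}$'') if $\$(\rho_{AB},O)\ge\$(\sigma_{AB'},O)$ for all such $\mathcal X$ and $O$. The composition $\omega_{XY}\otimes\rho_{AB}$ is regarded as an information structure with parts $XA$ and $YB$. A structure $\omega_{XY}$ is \emph{complete} if (i) the set of states $$\Big\{\tfrac{\operatorname{Tr}_X[(P\otimes 1)\omega_{XY}]}{\operatorname{Tr}[(P\otimes 1)\omega_{XY}]}\ :\ 0\le P\le 1 \text{ on } \mathcal H_X,\ \operatorname{Tr}[(P\otimes 1)\omega_{XY}]\neq0\Big\}$$ contains $(\dim\mathcal H_Y)^2$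 linearly independent density matrices, and (ii) for every linear map $L$ from the operators on $\mathcal H_Y$ to themselves, $(\mathrm{id}\otimes L)(\omega_{XY})=\omega_{XY}$ if and only if $L=\mathrm{id}$. \textbf{Proposition.} For quantum information structures $\rho_{AB}$ and $\sigma_{AB'}$, the following are equivalent: (1) $\sigma_{AB'}=(\mathrm{id}_A\otimes\mathcal E)(\rho_{AB})$ for some completely positive, trace-preserving linear map $\mathcal E$ from the operators on $\mathcal H_B$ to the operators on $\mathcal H_{B'}$; (2) $\omega_{XY}\otimes\rho_{AB}\supset_{XA}\omega_{XY}\otimes\sigma_{AB'}$ for every quantum information structure $\omega_{XY}$; (3) $\Psi_{XY}\otimes\rho_{AB}\supset_{XA}\Psi_{XY}\otimes\sigma_{AB'}$ for some maximally entangled pure state $\Psi_{XY}$ with $\mathcal H_X\cong\mathcal H_Y\cong\mathcal H_{B'}$; (4) $\omega_{XY}\otimes\rho_{AB}\supset_{XA}\omega_{XY}\otimes\sigma_{AB'}$ for some complete quantum information structure $\omega_{XY}$ with $\mathcal H_Y\cong\mathcal H_{B'}$. Moreover, let $\Psi_{XY}$ be a maximally entangled pure state with $\dim\mathcal H_X=\dim\mathcal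 H_Y=d$ and, for $p\in[0,1]$, let $\omega^p_{XY}=p\,\Psi_{XY}+(1-p)\,1_{XY}/d^2$ be the isotropic state. Then $\omega^p_{XY}$ is complete if $p\ne0$, and separable if $p\le\frac1{d+1}$; so for $0<p\le\frac1{d+1}$ it is both. -/

import Mathlib

open scoped Kronecker ComplexOrder
open Matrix

universe u

/-! Finite-dimensional Hilbert spaces are `ℂ^A` for a finite index type `A`, operators on them are
their representing matrices, and `ℂ^A ⊗ ℂ^B` is `ℂ^(A × B)`. -/

/-- Density matrices. -/
def IsDensityMatrix {A : Type*} [Fintype A] (ρ : Matrix A A ℂ) : Prop :=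
  ρ.PosSemidef ∧ ρ.trace = 1

/-- A quantum information structure: a density matrix on `ℂ^A ⊗ ℂ^B`. -/
structure QInfoStructure (A B : Type u) [Fintype A] [Fintype B] where
  state : Matrix (A × B) (A × B) ℂ
  isDensityMatrix : IsDensityMatrix state

/-- A positive-operator-valued measure on `ℂ^B` with outcomes in the finite decision set `I`. -/
structure POVM (I B : Type u) [Fintype I] [DecidableEq B] where
  elem : I → Matrix B B ℂ
  posSemidef : ∀ i, (elem i).PosSemidef
  sum_eq_one : ∑ i, elem i = 1

/-- `Tr_A`, the partial trace over the left factor. -/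
def partialTraceLeft {A B : Type*} [Fintype A] (M : Matrix (A × B) (A × B) ℂ) : Matrix B B ℂ :=
  Matrix.of fun b b' => ∑ a, M (a, b) (a, b')

/-- The map `id ⊗ E`, obtained by applying `E` to each of the `B`-blocks of a matrix on `C × B`. -/
def idTensor (C : Type*) {B B' : Type*} (E : Matrix B B ℂ →ₗ[ℂ] Matrix B' B' ℂ) :
    Matrix (C × B) (C × B) ℂ →ₗ[ℂ] Matrix (C × B') (C × B') ℂ where
  toFun M := Matrix.of fun p q => E (Matrix.of fun b b' => M (p.1, b) (q.1, b')) p.2 q.2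
  map_add' M N := by
    ext p q
    have h := E.map_add (Matrix.of fun b b' => M (p.1, b) (q.1, b'))
      (Matrix.of fun b b' => N (p.1, b) (q.1, b'))
    exact congrFun (congrFun h p.2) q.2
  map_smul' c M := by
    ext p q
    have h := E.map_smul c (Matrix.of fun b b' => M (p.1, b) (q.1, b'))
    exact congrFun (congrFun h p.2) q.2

theorem idTensor_kronecker {C B B' : Type*} (E : Matrix B B ℂ →ₗ[ℂ] Matrix B' B' ℂ)
    (S : Matrix C C ℂ) (T : Matrix B B ℂ) : idTensor C E (S ⊗ₖ T) = S ⊗ₖ E T := by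
  ext p q
  have h := E.map_smul (S p.1 q.1) T
  exact congrFun (congrFun h p.2) q.2

/-- Completely positive, trace-preserving linear maps. -/
def IsCPTP {B B' : Type*} [Fintype B] [Fintype B']
    (E : Matrix B B ℂ →ₗ[ℂ] Matrix B' B' ℂ) : Prop :=
  (∀ (n : ℕ) (M : Matrix (Fin n × B) (Fin n × B) ℂ),
    M.PosSemidef → (idTensor (Fin n) E M).PosSemidef) ∧
  ∀ M : Matrix B B ℂ, (E M).trace = M.trace

/-- A set of states on `ℂ^B` is complete if it contains `(dim ℂ^B)²` linearly independent density
matrices. -/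
def IsCompleteStateSpace {B : Type*} [Fintype B] (S : Set (Matrix B B ℂ)) : Prop :=
  ∃ f : Fin (Fintype.card B ^ 2) → Matrix B B ℂ,
    (∀ i, f i ∈ S ∧ IsDensityMatrix (f i)) ∧ LinearIndependent ℂ f

namespace QInfoStructure

variable {A B B' X Y : Type u} [Fintype A] [Fintype B] [Fintype B'] [Fintype X] [Fintype Y]

/-- `∑ i, Tr[(O i ⊗ P i) ρ]`; this trace is real for self-adjoint `O i`. -/
def expectedPayoff [DecidableEq B] (ρ : QInfoStructure A B) {I : Type u} [Fintype I]
    (O : I → Matrix A A ℂ) (P : POVM I B) : ℝ :=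
  (∑ i, ((O i ⊗ₖ P.elem i) * ρ.state).trace).re

/-- The maximum expected payoff over all strategies (the set of POVMs is compact, so that the
supremum over it is a maximum). -/
noncomputable def maxPayoff [DecidableEq B] (ρ : QInfoStructure A B) {I : Type u} [Fintype I]
    (O : I → Matrix A A ℂ) : ℝ :=
  ⨆ P : POVM I B, ρ.expectedPayoff O P

/-- `ρ` is always more informative than `σ` (with respect to the common left factor `A`). -/
def MoreInformative [DecidableEq B] [DecidableEq B'] (ρ : QInfoStructure A B)
    (σ : QInfoStructure A B') : Prop :=
  ∀ (I : Type u) [Fintype I] [Nonempty I] (O : I → Matrix A A ℂ), (∀ i, (O i).IsHermitian) →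
    σ.maxPayoff O ≤ ρ.maxPayoff O

/-- `ρ` is sufficient for `σ`: some CPTP map `E` satisfies `σ = (id ⊗ E) ρ`. -/
def Sufficient (ρ : QInfoStructure A B) (σ : QInfoStructure A B') : Prop :=
  ∃ E : Matrix B B ℂ →ₗ[ℂ] Matrix B' B' ℂ, IsCPTP E ∧ σ.state = idTensor A E ρ.state

/-- The composition `ω_XY ⊗ ρ_AB`, as a structure with left factor `X × A` and right factor
`Y × B`. -/
def comp (ω : QInfoStructure X Y) (ρ : QInfoStructure A B) : QInfoStructure (X × A) (Y × B) where
  state := (ω.state ⊗ₖ ρ.state).submatrix (Equiv.prodProdProdComm X A Y B)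
    (Equiv.prodProdProdComm X A Y B)
  isDensityMatrix := by
    classical
    refine ⟨(ω.isDensityMatrix.1.kronecker ρ.isDensityMatrix.1).submatrix _, ?_⟩
    have h : ((ω.state ⊗ₖ ρ.state).submatrix (Equiv.prodProdProdComm X A Y B)
        (Equiv.prodProdProdComm X A Y B)).trace = (ω.state ⊗ₖ ρ.state).trace :=
      Equiv.sum_comp (Equiv.prodProdProdComm X A Y B) fun i => (ω.state ⊗ₖ ρ.state) i i
    rw [h, trace_kronecker, ω.isDensityMatrix.2, ρ.isDensityMatrix.2, one_mul]

/-- The local state space of `ω_XY` on `Y`: the normalized operators `Tr_X[(P ⊗ 1) ω]` with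
`0 ≤ P ≤ 1`, whenever the normalization is possible. -/
def localStateSpace [DecidableEq X] [DecidableEq Y] (ω : QInfoStructure X Y) :
    Set (Matrix Y Y ℂ) :=
  {τ | ∃ P : Matrix X X ℂ, P.PosSemidef ∧ (1 - P).PosSemidef ∧
    ((P ⊗ₖ (1 : Matrix Y Y ℂ)) * ω.state).trace ≠ 0 ∧
    τ = (((P ⊗ₖ (1 : Matrix Y Y ℂ)) * ω.state).trace)⁻¹ •
      partialTraceLeft ((P ⊗ₖ (1 : Matrix Y Y ℂ)) * ω.state)}

/-- Complete information structures. -/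
def IsComplete [DecidableEq X] [DecidableEq Y] (ω : QInfoStructure X Y) : Prop :=
  IsCompleteStateSpace ω.localStateSpace ∧
  ∀ L : Matrix Y Y ℂ →ₗ[ℂ] Matrix Y Y ℂ, idTensor X L ω.state = ω.state ↔ L = LinearMap.id

/-- The state is a maximally entangled pure state `|ψ⟩⟨ψ|`, where
`ψ = d^(-1/2) ∑ k, e k ⊗ f k` for orthonormal bases `e` of `ℂ^X` and `f` of `ℂ^Y`,
`d = dim ℂ^X = dim ℂ^Y`. -/
def IsMaximallyEntangled (ω : QInfoStructure X Y) : Prop :=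
  ∃ (e : OrthonormalBasis Y ℂ (EuclideanSpace ℂ X))
    (f : OrthonormalBasis Y ℂ (EuclideanSpace ℂ Y)) (ψ : X × Y → ℂ),
    (∀ x y, ψ (x, y) = ((Real.sqrt (Fintype.card Y))⁻¹ : ℝ) * ∑ k, e k x * f k y) ∧
    ω.state = vecMulVec ψ (star ψ)

/-- Separable structures: finite convex combinations of product states. -/
def IsSeparable (ω : QInfoStructure X Y) : Prop :=
  ∃ (n : ℕ) (c : Fin n → ℝ) (α : Fin n → Matrix X X ℂ) (β : Fin n → Matrix Y Y ℂ),
    (∀ i, 0 ≤ c i ∧ IsDensityMatrix (α i) ∧ IsDensityMatrix (β i)) ∧ ∑ i, c i = 1 ∧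
    ω.state = ∑ i, (c i : ℂ) • (α i ⊗ₖ β i)

/-- The mixture `p Ψ + (1 - p) 1 / (dim ℂ^X · dim ℂ^Y)`, an isotropic state if `Ψ` is maximally
entangled. -/
noncomputable def isotropic [DecidableEq X] [DecidableEq Y] (Ψ : QInfoStructure X Y) (p : ℝ)
    (hp : p ∈ Set.Icc (0 : ℝ) 1) : QInfoStructure X Y where
  state := (p : ℂ) • Ψ.state +
    ((1 - p : ℝ) / (Fintype.card X * Fintype.card Y) : ℂ) • (1 : Matrix (X × Y) (X × Y) ℂ)
  isDensityMatrix := by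
    have hc : (Fintype.card X * Fintype.card Y : ℂ) ≠ 0 := by
      intro h
      have h0 : Fintype.card (X × Y) = 0 := by
        rw [Fintype.card_prod]; exact_mod_cast h
      have := Fintype.card_eq_zero_iff.mp h0
      have h1 := Ψ.isDensityMatrix.2
      simp [Matrix.trace] at h1
    refine ⟨(Ψ.isDensityMatrix.1.smul (by exact_mod_cast hp.1)).add (PosSemidef.one.smul ?_), ?_⟩
    · have : (0 : ℝ) ≤ (1 - p) / (Fintype.card X * Fintype.card Y) :=
        div_nonneg (by linarith [hp.2]) (by positivity)
      exact_mod_cast this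
    · rw [trace_add, trace_smul, trace_smul, Ψ.isDensityMatrix.2, trace_one, Fintype.card_prod,
        smul_eq_mul, smul_eq_mul, Nat.cast_mul, div_mul_cancel₀ _ hc]
      push_cast; ring

end QInfoStructure

/-! If a channel turns `ρ` into `σ`, a POVM on its output pulls back along the dual map with the
same payoff, even beside an auxiliary `ω` (`Sufficient.comp_moreInformative`).

The converse is teleportation in disguise. POVMs form a compact convex set. If a POVM on the less
informative side produced conditional operators that no POVM on the other side matches, a separating
functional, symmetrised, would be a decision problem violating the payoff inequality
(`MoreInformative.exists_povm`). Apply this to a Bell measurement on `Y × B'`, built from a unitary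
operator basis `U i`: some POVM `Q` on `Y × B` has the same statistics. When the `Y`-blocks of `ω`
span all operators, the equality extends from those blocks to every operator `τ` on `Y`
(`exists_trace_eq_of_comp_moreInformative`). Matrix units conjugated by `U i` then read off the
entries of `σ`, and factors of the `Q i` supply the Kraus operators of the channel
(`sufficient_of_comp_moreInformative`).

An isotropic state steers `Y` to `p N + (1 - p) 1/d` for every density matrix `N`. For `p ≠ 0` this
comes from an injective linear map, so these states span. For `p ≤ 1/(d+1)`, separability follows by
averaging products of phase vectors over characters (`sum_addChar_kronecker`). The maximally
entangled state is the case `p = 1`. -/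

namespace Matrix

/-! ### Positive semidefinite matrices and the self-duality of their cone -/

section PosSemidefFacts

open scoped MatrixOrder Matrix.Norms.L2Operator

theorem PosSemidef.exists_eq_conjTranspose_mul_self {n : Type*} [Fintype n]
    {M : Matrix n n ℂ} (hM : M.PosSemidef) : ∃ R : Matrix n n ℂ, M = Rᴴ * R := by
  classical
  obtain ⟨R, hR⟩ := CStarAlgebra.nonneg_iff_eq_star_mul_self.mp hM.nonneg
  exact ⟨R, hR⟩

theorem span_posSemidef (n : Type*) [Fintype n] :
    Submodule.span ℂ {M : Matrix n n ℂ | M.PosSemidef} = ⊤ := by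
  classical
  have h := CStarAlgebra.span_nonneg (A := Matrix n n ℂ)
  simpa only [nonneg_iff_posSemidef] using h

end PosSemidefFacts

theorem PosSemidef.trace_mul_nonneg {n : Type*} [Fintype n] {M N : Matrix n n ℂ}
    (hM : M.PosSemidef) (hN : N.PosSemidef) : 0 ≤ (M * N).trace := by
  obtain ⟨R, rfl⟩ := hM.exists_eq_conjTranspose_mul_self
  rw [trace_mul_comm, ← Matrix.mul_assoc, trace_mul_comm, ← Matrix.mul_assoc]
  exact (hN.mul_mul_conjTranspose_same R).trace_nonneg

/-- Testing against rank-one projectors makes the quadratic form nonnegative; over `ℂ`, a real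
quadratic form already forces the matrix to be Hermitian. -/
theorem posSemidef_of_trace_mul_nonneg {n : Type*} [Fintype n] {M : Matrix n n ℂ}
    (h : ∀ N : Matrix n n ℂ, N.PosSemidef → 0 ≤ (M * N).trace) : M.PosSemidef := by
  classical
  have key : ∀ x : n → ℂ, 0 ≤ star x ⬝ᵥ (M *ᵥ x) := fun x => by
    have := h _ (posSemidef_vecMulVec_self_star x)
    rwa [mul_vecMulVec, trace_vecMulVec, dotProduct_comm] at this
  refine PosSemidef.of_dotProduct_mulVec_nonneg ?_ key
  rw [← isSymmetric_toEuclideanLin_iff, LinearMap.isSymmetric_iff_inner_map_self_real]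
  intro v
  have h2 := key v.ofLp
  have h3 : inner ℂ (toEuclideanLin M v) v = star (star v.ofLp ⬝ᵥ (M *ᵥ v.ofLp)) := by
    rw [← inner_conj_symm, EuclideanSpace.inner_eq_star_dotProduct, dotProduct_comm]
    rfl
  rw [h3]
  have := (Complex.le_def.mp h2).2
  apply Complex.ext
  · simp
  · simp at this ⊢
    simp [← this]

theorem span_isDensityMatrix (n : Type*) [Fintype n] :
    Submodule.span ℂ {M : Matrix n n ℂ | IsDensityMatrix M} = ⊤ := by
  rw [eq_top_iff, ← span_posSemidef, Submodule.span_le]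
  intro M hM
  have hM : M.PosSemidef := hM
  by_cases ht : M.trace = 0
  · rw [hM.trace_eq_zero_iff.mp ht]
    exact Submodule.zero_mem _
  · have h1 : IsDensityMatrix (M.trace⁻¹ • M) :=
      ⟨hM.smul (inv_nonneg.mpr hM.trace_nonneg), by
        rw [trace_smul, smul_eq_mul, inv_mul_cancel₀ ht]⟩
    have h2 : M = M.trace • (M.trace⁻¹ • M) := by rw [smul_smul, mul_inv_cancel₀ ht, one_smul]
    rw [h2]
    exact Submodule.smul_mem _ _ (Submodule.subset_span h1)

/-! ### Completely positive maps: Kraus form and trace dual -/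

/-- The linear map `M ↦ K M Kᴴ`. -/
def conjLinear {m n : Type*} [Fintype n] (K : Matrix m n ℂ) :
    Matrix n n ℂ →ₗ[ℂ] Matrix m m ℂ where
  toFun M := K * M * Kᴴ
  map_add' M N := by rw [Matrix.mul_add, Matrix.add_mul]
  map_smul' c M := by simp

end Matrix

theorem idTensor_conjLinear {C m n : Type*} [Fintype C] [DecidableEq C] [Fintype n]
    (K : Matrix m n ℂ) (M : Matrix (C × n) (C × n) ℂ) :
    idTensor C (conjLinear K) M = ((1 : Matrix C C ℂ) ⊗ₖ K) * M * ((1 : Matrix C C ℂ) ⊗ₖ K)ᴴ := by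
  ext ⟨c, i⟩ ⟨c', i'⟩
  simp [idTensor, conjLinear, Matrix.mul_apply, Fintype.sum_prod_type, Matrix.one_apply,
    apply_ite, Finset.sum_mul]

theorem isCPTP_sum_conjLinear {m n ι : Type*} [Fintype m] [Fintype n] [DecidableEq n] [Fintype ι]
    (K : ι → Matrix m n ℂ) (hK : ∑ i, (K i)ᴴ * K i = 1) : IsCPTP (∑ i, conjLinear (K i)) := by
  classical
  refine ⟨fun N M hM => ?_, fun M => ?_⟩
  · have h : idTensor (Fin N) (∑ i, conjLinear (K i)) M
        = ∑ i, idTensor (Fin N) (conjLinear (K i)) M := by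
      ext p q
      simp [idTensor, Matrix.sum_apply, LinearMap.sum_apply]
    rw [h]
    refine posSemidef_sum _ fun i _ => ?_
    rw [idTensor_conjLinear]
    exact hM.mul_mul_conjTranspose_same _
  · calc ((∑ i, conjLinear (K i)) M).trace = ∑ i, ((K i)ᴴ * K i * M).trace := by
          rw [LinearMap.sum_apply, trace_sum]
          refine Finset.sum_congr rfl fun i _ => ?_
          change (K i * M * (K i)ᴴ).trace = _
          rw [trace_mul_comm, ← Matrix.mul_assoc]
      _ = M.trace := by rw [← trace_sum, ← Finset.sum_mul, hK, Matrix.one_mul]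

/-- The definition tests ancillas `Fin n` only; reindexing transports positivity to any finite
ancilla. -/
theorem IsCPTP.posSemidef_idTensor {m n C : Type*} [Fintype m] [Fintype n] [Fintype C]
    {E : Matrix m m ℂ →ₗ[ℂ] Matrix n n ℂ} (hE : IsCPTP E) {M : Matrix (C × m) (C × m) ℂ}
    (hM : M.PosSemidef) : (idTensor C E M).PosSemidef := by
  let e := Fintype.equivFin C
  have h := hE.1 _ _ (hM.submatrix (Prod.map e.symm id))
  have h2 := h.submatrix (Prod.map e id)
  convert h2 using 1
  ext p q
  simp [idTensor]

/-- The `(a, a')` block of a matrix on `A × B`. -/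
def rightBlock {A B : Type*} (S : Matrix (A × B) (A × B) ℂ) (a a' : A) : Matrix B B ℂ :=
  Matrix.of fun b b' => S (a, b) (a', b')

theorem trace_kronecker_mul {A B : Type*} [Fintype A] [Fintype B] (O : Matrix A A ℂ)
    (Q : Matrix B B ℂ) (S : Matrix (A × B) (A × B) ℂ) :
    ((O ⊗ₖ Q) * S).trace = ∑ a, ∑ a', O a a' * (Q * rightBlock S a' a).trace := by
  simp only [Matrix.trace, Matrix.diag, Matrix.mul_apply, Fintype.sum_prod_type, rightBlock,
    Matrix.of_apply, kronecker_apply, Finset.mul_sum]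
  refine Finset.sum_congr rfl fun a _ => ?_
  rw [Finset.sum_comm]
  simp only [mul_assoc]

theorem rightBlock_idTensor {A B B' : Type*} (E : Matrix B B ℂ →ₗ[ℂ] Matrix B' B' ℂ)
    (S : Matrix (A × B) (A × B) ℂ) (a a' : A) :
    rightBlock (idTensor A E S) a a' = E (rightBlock S a a') := rfl

theorem ext_rightBlock {A B : Type*} {S T : Matrix (A × B) (A × B) ℂ}
    (h : ∀ a a', rightBlock S a a' = rightBlock T a a') : S = T := by
  ext p q
  exact congrFun (congrFun (h p.1 q.1) p.2) q.2

theorem QInfoStructure.rightBlock_comp {A B X Y : Type u} [Fintype A] [Fintype B] [Fintype X]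
    [Fintype Y] (ω : QInfoStructure X Y) (ρ : QInfoStructure A B) (p q : X × A) :
    rightBlock (ω.comp ρ).state p q = rightBlock ω.state p.1 q.1 ⊗ₖ rightBlock ρ.state p.2 q.2 :=
  rfl

/-- The adjoint of `id ⊗ E` with respect to the trace pairing. -/
def idTensorDual {C B B' : Type*} [Fintype B'] [DecidableEq B]
    (E : Matrix B B ℂ →ₗ[ℂ] Matrix B' B' ℂ) (P : Matrix (C × B') (C × B') ℂ) :
    Matrix (C × B) (C × B) ℂ :=
  Matrix.of fun p q => (rightBlock P p.1 q.1 * E (Matrix.single q.2 p.2 1)).trace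

theorem trace_idTensorDual_mul {C B B' : Type*} [Fintype C] [Fintype B] [Fintype B']
    [DecidableEq B] (E : Matrix B B ℂ →ₗ[ℂ] Matrix B' B' ℂ) (P : Matrix (C × B') (C × B') ℂ)
    (M : Matrix (C × B) (C × B) ℂ) :
    (idTensorDual E P * M).trace = (P * idTensor C E M).trace := by
  have hE : ∀ N : Matrix B B ℂ, E N = ∑ b, ∑ b', N b b' • E (Matrix.single b b' 1) := fun N => by
    conv_lhs => rw [matrix_eq_sum_single N]
    simp only [map_sum]
    refine Finset.sum_congr rfl fun b _ => Finset.sum_congr rfl fun b' _ => ?_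
    rw [← map_smul, smul_single, smul_eq_mul, mul_one]
  have h1 : (P * idTensor C E M).trace
      = ∑ c, ∑ c', (rightBlock P c c' * E (rightBlock M c' c)).trace := by
    simp only [Matrix.trace, Matrix.diag, Matrix.mul_apply, Fintype.sum_prod_type]
    refine Finset.sum_congr rfl fun c _ => ?_
    rw [Finset.sum_comm]
    rfl
  rw [h1]
  simp only [Matrix.trace, Matrix.diag, Matrix.mul_apply (M := idTensorDual E P),
    Fintype.sum_prod_type]
  refine Finset.sum_congr rfl fun c _ => ?_
  rw [Finset.sum_comm]
  refine Finset.sum_congr rfl fun c' _ => ?_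
  change _ = (rightBlock P c c' * E (rightBlock M c' c)).trace
  rw [hE (rightBlock M c' c), Finset.mul_sum, trace_sum, Finset.sum_comm]
  refine Finset.sum_congr rfl fun b _ => ?_
  rw [Finset.mul_sum, trace_sum]
  refine Finset.sum_congr rfl fun b' _ => ?_
  rw [mul_smul_comm, trace_smul, smul_eq_mul, mul_comm]
  rfl

theorem IsCPTP.posSemidef_idTensorDual {C B B' : Type*} [Fintype C] [Fintype B] [Fintype B']
    [DecidableEq B] {E : Matrix B B ℂ →ₗ[ℂ] Matrix B' B' ℂ} (hE : IsCPTP E)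
    {P : Matrix (C × B') (C × B') ℂ} (hP : P.PosSemidef) : (idTensorDual E P).PosSemidef :=
  posSemidef_of_trace_mul_nonneg fun N hN => by
    rw [trace_idTensorDual_mul]
    exact hP.trace_mul_nonneg (hE.posSemidef_idTensor hN)

/-! ### Pulling POVMs back along channels -/

/-- The pullback of a POVM along a quantum operation on the second factor. -/
def POVM.pullback {I C B B' : Type u} [Fintype I] [Fintype C] [DecidableEq C] [Fintype B]
    [Fintype B'] [DecidableEq B] [DecidableEq B'] (P : POVM I (C × B'))
    (E : Matrix B B ℂ →ₗ[ℂ] Matrix B' B' ℂ) (hE : IsCPTP E) : POVM I (C × B) where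
  elem i := idTensorDual E (P.elem i)
  posSemidef i := hE.posSemidef_idTensorDual (P.posSemidef i)
  sum_eq_one := by
    have h : ∑ i, idTensorDual E (P.elem i) = idTensorDual E (∑ i, P.elem i) := by
      ext p q
      simp only [Matrix.sum_apply, idTensorDual, Matrix.of_apply]
      rw [← trace_sum, ← Finset.sum_mul]
      congr 2
      ext b b'
      simp [rightBlock, Matrix.sum_apply]
    rw [h, P.sum_eq_one]
    ext ⟨c, b⟩ ⟨c', b'⟩
    have h1 : rightBlock (1 : Matrix (C × B') (C × B') ℂ) c c'
        = if c = c' then (1 : Matrix B' B' ℂ) else 0 := by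
      ext x y
      by_cases hc : c = c' <;> simp [rightBlock, Matrix.one_apply, hc]
    simp only [idTensorDual, Matrix.of_apply, h1]
    by_cases hc : c = c'
    · subst hc
      simp only [if_true, Matrix.one_mul, hE.2]
      by_cases hb : b = b'
      · subst hb
        rw [trace_single_eq_same, one_apply_eq]
      · simp [hb, trace_single_eq_of_ne _ _ _ (Ne.symm hb)]
    · simp [hc]

namespace QInfoStructure

variable {A B B' X Y : Type u} [Fintype A] [Fintype B] [Fintype B'] [Fintype X] [Fintype Y]

theorem expectedPayoff_eq [DecidableEq B] (ρ : QInfoStructure A B) {I : Type u} [Fintype I]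
    (O : I → Matrix A A ℂ) (P : POVM I B) :
    ρ.expectedPayoff O P
      = (∑ i, ∑ a, ∑ a', O i a a' * (P.elem i * rightBlock ρ.state a' a).trace).re := by
  simp only [expectedPayoff, trace_kronecker_mul]

theorem expectedPayoff_pullback [DecidableEq Y] [DecidableEq B] [DecidableEq B']
    {ρ : QInfoStructure A B} {σ : QInfoStructure A B'} {E : Matrix B B ℂ →ₗ[ℂ] Matrix B' B' ℂ}
    (hE : IsCPTP E) (h : σ.state = idTensor A E ρ.state) (ω : QInfoStructure X Y)
    {I : Type u} [Fintype I] (O : I → Matrix (X × A) (X × A) ℂ) (P : POVM I (Y × B')) :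
    (ω.comp ρ).expectedPayoff O (P.pullback E hE) = (ω.comp σ).expectedPayoff O P := by
  simp only [expectedPayoff_eq, rightBlock_comp, POVM.pullback, trace_idTensorDual_mul,
    idTensor_kronecker, h, rightBlock_idTensor]

end QInfoStructure

/-! ### Geometry of the set of POVMs and separation -/

theorem POVM.norm_factor_le {I B : Type*} [Fintype I] [Fintype B] [DecidableEq B]
    {R : I → Matrix B B ℂ} (h : ∑ i, (R i)ᴴ * R i = 1) (i : I) (k j : B) : ‖R i k j‖ ≤ 1 := by
  have h1 : ∑ i, ∑ k, ‖R i k j‖ ^ 2 = 1 := by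
    have := congrFun (congrFun h j) j
    simp only [Matrix.sum_apply, Matrix.mul_apply, conjTranspose_apply, one_apply_eq,
      RCLike.star_def, Complex.conj_mul'] at this
    exact_mod_cast this
  have h2 : ‖R i k j‖ ^ 2 ≤ ∑ k, ‖R i k j‖ ^ 2 :=
    Finset.single_le_sum (f := fun k => ‖R i k j‖ ^ 2) (fun _ _ => by positivity)
      (Finset.mem_univ k)
  have h3 : ∑ k, ‖R i k j‖ ^ 2 ≤ ∑ i, ∑ k, ‖R i k j‖ ^ 2 :=
    Finset.single_le_sum (f := fun i => ∑ k, ‖R i k j‖ ^ 2) (fun _ _ => by positivity)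
      (Finset.mem_univ i)
  have h4 : ‖R i k j‖ ^ 2 ≤ 1 := by linarith
  exact (sq_le_one_iff₀ (norm_nonneg _)).mp h4

/-- Writing each element as `Rᴴ * R` exhibits the POVMs as a continuous image of the closed set `∑
i, (R i)ᴴ * R i = 1`, whose entries lie in the unit disc. -/
theorem POVM.isCompact_range_elem (I B : Type u) [Fintype I] [Fintype B] [DecidableEq B] :
    IsCompact (Set.range fun P : POVM I B => P.elem) := by
  have hK : IsCompact {R : I → Matrix B B ℂ | ∑ i, (R i)ᴴ * R i = 1} := by
    have hc : IsCompact (Set.univ.pi fun _ : I => Set.univ.pi fun _ : B => Set.univ.pi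
        fun _ : B => Metric.closedBall (0 : ℂ) 1) :=
      isCompact_univ_pi fun _ => isCompact_univ_pi fun _ => isCompact_univ_pi fun _ =>
        isCompact_closedBall _ _
    refine IsCompact.of_isClosed_subset hc ?_ ?_
    · exact isClosed_eq (by fun_prop) continuous_const
    · intro R hR i _ k _ j _
      simpa using POVM.norm_factor_le hR i k j
  have himg : (Set.range fun P : POVM I B => P.elem)
      = (fun R : I → Matrix B B ℂ => fun i => (R i)ᴴ * R i) ''
        {R | ∑ i, (R i)ᴴ * R i = 1} := by
    ext Q
    constructor
    · rintro ⟨P, rfl⟩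
      choose R hR using fun i => (P.posSemidef i).exists_eq_conjTranspose_mul_self
      refine ⟨R, ?_, funext fun i => (hR i).symm⟩
      have := P.sum_eq_one
      simp only [hR] at this
      exact this
    · rintro ⟨R, hR, rfl⟩
      exact ⟨⟨_, fun i => posSemidef_conjTranspose_mul_self (R i), hR⟩, rfl⟩
  rw [himg]
  exact hK.image (by fun_prop)

theorem POVM.convex_range_elem (I B : Type u) [Fintype I] [Fintype B] [DecidableEq B] :
    Convex ℝ (Set.range fun P : POVM I B => P.elem) := by
  rintro _ ⟨P, rfl⟩ _ ⟨Q, rfl⟩ a b ha hb hab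
  refine ⟨⟨fun i => a • P.elem i + b • Q.elem i, fun i => ?_, ?_⟩, rfl⟩
  · exact ((P.posSemidef i).smul ha).add ((Q.posSemidef i).smul hb)
  · rw [Finset.sum_add_distrib, ← Finset.smul_sum, ← Finset.smul_sum, P.sum_eq_one, Q.sum_eq_one,
      ← add_smul, hab, one_smul]

instance POVM.instNonempty (I B : Type u) [Fintype I] [Nonempty I] [Fintype B] [DecidableEq B] :
    Nonempty (POVM I B) := by
  classical
  refine ⟨⟨Pi.single (Classical.arbitrary I) 1, fun i => ?_, ?_⟩⟩
  · by_cases h : i = Classical.arbitrary I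
    · rw [h, Pi.single_eq_same]
      exact PosSemidef.one
    · rw [Pi.single_eq_of_ne h]
      exact PosSemidef.zero
  · exact Finset.sum_pi_single' _ _ _ |>.trans (by simp)

namespace QInfoStructure

variable {A B B' X Y : Type u} [Fintype A] [Fintype B] [Fintype B'] [Fintype X] [Fintype Y]

theorem bddAbove_range_expectedPayoff [DecidableEq B] (ρ : QInfoStructure A B) {I : Type u}
    [Fintype I] (O : I → Matrix A A ℂ) :
    BddAbove (Set.range fun P : POVM I B => ρ.expectedPayoff O P) := by
  have hc : Continuous fun Q : I → Matrix B B ℂ => (∑ i, ((O i ⊗ₖ Q i) * ρ.state).trace).re := by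
    simp only [trace_kronecker_mul]
    fun_prop
  have := ((POVM.isCompact_range_elem I B).image hc).bddAbove
  rwa [← Set.range_comp] at this

theorem Sufficient.comp_moreInformative [DecidableEq B] [DecidableEq B'] [DecidableEq Y]
    {ρ : QInfoStructure A B} {σ : QInfoStructure A B'} (h : ρ.Sufficient σ)
    (ω : QInfoStructure X Y) : (ω.comp ρ).MoreInformative (ω.comp σ) := by
  obtain ⟨E, hE, hσ⟩ := h
  intro I _ _ O _
  refine ciSup_le fun P => ?_
  rw [← expectedPayoff_pullback hE hσ]
  exact le_ciSup (bddAbove_range_expectedPayoff _ O) (P.pullback E hE)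

/-- A more informative structure can reproduce, by some POVM, all the conditional operators on the
left factor that a POVM on the less informative structure yields. -/
theorem MoreInformative.exists_povm [DecidableEq B] [DecidableEq B']
    {ρ : QInfoStructure A B} {σ : QInfoStructure A B'} (h : ρ.MoreInformative σ)
    {I : Type u} [Fintype I] [Nonempty I] (P : POVM I B') :
    ∃ Q : POVM I B, ∀ i a a', (P.elem i * rightBlock σ.state a a').trace
      = (Q.elem i * rightBlock ρ.state a a').trace := by
  classical
  let T : (I → Matrix B B ℂ) →ₗ[ℝ] (I × A × A → ℂ) :=
    { toFun := fun Q p => (Q p.1 * rightBlock ρ.state p.2.1 p.2.2).trace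
      map_add' := fun Q Q' => by
        ext p
        simp [Matrix.add_mul]
      map_smul' := fun c Q => by
        ext p
        simp [trace_smul] }
  have hT : Continuous T := by
    change Continuous fun (Q : I → Matrix B B ℂ) (p : I × A × A) =>
      (Q p.1 * rightBlock ρ.state p.2.1 p.2.2).trace
    fun_prop
  let v : I × A × A → ℂ := fun p => (P.elem p.1 * rightBlock σ.state p.2.1 p.2.2).trace
  by_cases hv : v ∈ T '' (Set.range fun P : POVM I B => P.elem)
  · obtain ⟨_, ⟨Q, rfl⟩, hQ⟩ := hv
    exact ⟨Q, fun i a a' => (congrFun hQ (i, a, a')).symm⟩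
  exfalso
  obtain ⟨f, s, t, hs, hst, ht⟩ := RCLike.geometric_hahn_banach_compact_closed (𝕜 := ℂ)
    ((POVM.convex_range_elem I B).linear_image T) ((POVM.isCompact_range_elem I B).image hT)
    (convex_singleton v) isClosed_singleton (Set.disjoint_singleton_right.mpr hv)
  -- The coefficients of `f` are the payoff operators; `a` and `a'` are swapped because the trace
  -- pairs `O a a'` with the block at `(a', a)`.
  let O' : I → Matrix A A ℂ := fun i => Matrix.of fun a a' => f (Pi.single (i, a', a) 1)
  let O : I → Matrix A A ℂ := fun i => O' i + (O' i)ᴴ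
  have hO : ∀ i, (O i).IsHermitian := fun i => isHermitian_add_transpose_self (O' i)
  have hf : ∀ w : I × A × A → ℂ, f w = ∑ i, ∑ a, ∑ a', O' i a a' * w (i, a', a) := fun w => by
    conv_lhs => rw [pi_eq_sum_univ' w]
    rw [map_sum, Fintype.sum_prod_type]
    refine Finset.sum_congr rfl fun i _ => ?_
    rw [Fintype.sum_prod_type, Finset.sum_comm]
    refine Finset.sum_congr rfl fun a _ => Finset.sum_congr rfl fun a' _ => ?_
    rw [map_smul, smul_eq_mul, mul_comm]
    congr 2
  have key : ∀ {C : Type u} [Fintype C] [DecidableEq C] (τ : QInfoStructure A C) (Q : POVM I C),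
      τ.expectedPayoff O Q
        = 2 * (f fun p => (Q.elem p.1 * rightBlock τ.state p.2.1 p.2.2).trace).re := by
    intro C _ _ τ Q
    -- Passing to the adjoint conjugates the trace, so the Hermitian `O' + O'ᴴ` pays exactly twice
    -- the real part of `f`.
    have h1 : ∀ i, ((((O' i)ᴴ ⊗ₖ Q.elem i) * τ.state).trace).re
        = (((O' i ⊗ₖ Q.elem i) * τ.state).trace).re := fun i => by
      have : (((O' i)ᴴ ⊗ₖ Q.elem i) * τ.state).trace
          = star (((O' i ⊗ₖ Q.elem i) * τ.state).trace) := by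
        rw [← trace_conjTranspose, conjTranspose_mul, conjTranspose_kronecker,
          (Q.posSemidef i).isHermitian.eq, τ.isDensityMatrix.1.isHermitian.eq, trace_mul_comm]
      rw [this]
      simp
    rw [hf]
    simp only [← trace_kronecker_mul, expectedPayoff, O, add_kronecker, Matrix.add_mul, trace_add,
      Complex.re_sum, Complex.add_re, h1]
    rw [Finset.mul_sum]
    refine Finset.sum_congr rfl fun i _ => by ring
  have h1 : ρ.maxPayoff O ≤ 2 * s := ciSup_le fun Q => by
    rw [key]
    have := hs _ ⟨_, ⟨Q, rfl⟩, rfl⟩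
    exact mul_le_mul_of_nonneg_left this.le (by norm_num)
  have h2 : 2 * t < σ.expectedPayoff O P := by
    rw [key]
    have := ht v rfl
    exact mul_lt_mul_of_pos_left this (by norm_num)
  have h3 := le_ciSup (bddAbove_range_expectedPayoff σ O) P
  have h4 := h I O hO
  have h5 : σ.expectedPayoff O P ≤ σ.maxPayoff O := h3
  linarith

end QInfoStructure

/-! ### Local state spaces and completeness -/

theorem partialTraceLeft_kronecker_one_mul {X Y : Type*} [Fintype X] [Fintype Y] [DecidableEq Y]
    (P : Matrix X X ℂ) (S : Matrix (X × Y) (X × Y) ℂ) :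
    partialTraceLeft ((P ⊗ₖ (1 : Matrix Y Y ℂ)) * S) = ∑ x, ∑ x', P x x' • rightBlock S x' x := by
  ext y y'
  simp [partialTraceLeft, Matrix.mul_apply, Fintype.sum_prod_type, Matrix.sum_apply, rightBlock,
    Matrix.one_apply]

theorem trace_partialTraceLeft {X Y : Type*} [Fintype X] [Fintype Y]
    (M : Matrix (X × Y) (X × Y) ℂ) : (partialTraceLeft M).trace = M.trace := by
  simp only [partialTraceLeft, Matrix.trace, Matrix.diag, Fintype.sum_prod_type, Matrix.of_apply]
  exact Finset.sum_comm

theorem IsCompleteStateSpace.span_eq_top {B : Type*} [Fintype B] {S : Set (Matrix B B ℂ)}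
    (h : IsCompleteStateSpace S) : Submodule.span ℂ S = ⊤ := by
  obtain ⟨f, hf, hli⟩ := h
  have := hli.span_eq_top_of_card_eq_finrank' (by simp [Module.finrank_matrix, sq])
  rw [eq_top_iff, ← this, Submodule.span_le]
  rintro _ ⟨i, rfl⟩
  exact Submodule.subset_span (hf i).1

theorem isCompleteStateSpace_of_span_eq_top {B : Type*} [Fintype B] {S : Set (Matrix B B ℂ)}
    (hS : ∀ τ ∈ S, IsDensityMatrix τ) (h : Submodule.span ℂ S = ⊤) : IsCompleteStateSpace S := by
  let b := Module.Basis.ofSpan h.ge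
  have : Fintype ((linearIndepOn_empty ℂ (id : Matrix B B ℂ → _)).extend (Set.empty_subset S)) :=
    FiniteDimensional.fintypeBasisIndex b
  have hc := Module.finrank_eq_card_basis b
  rw [Module.finrank_matrix, Module.finrank_self, mul_one, ← sq] at hc
  let e := (Fintype.equivFinOfCardEq hc.symm).symm
  have hmem : ∀ i, b (e i) ∈ S := fun i => Module.Basis.ofSpan_subset h.ge ⟨e i, rfl⟩
  exact ⟨fun i => b (e i), fun i => ⟨hmem i, hS _ (hmem i)⟩,
    b.linearIndependent.comp _ e.injective⟩

namespace QInfoStructure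

variable {A B B' X Y : Type u} [Fintype A] [Fintype B] [Fintype B'] [Fintype X] [Fintype Y]

theorem span_rightBlock_eq_top [DecidableEq X] [DecidableEq Y] {ω : QInfoStructure X Y}
    (h : IsCompleteStateSpace ω.localStateSpace) :
    Submodule.span ℂ (Set.range fun p : X × X => rightBlock ω.state p.1 p.2) = ⊤ := by
  rw [eq_top_iff, ← h.span_eq_top, Submodule.span_le]
  rintro _ ⟨P, -, -, -, rfl⟩
  rw [partialTraceLeft_kronecker_one_mul]
  refine Submodule.smul_mem _ _ (Submodule.sum_mem _ fun x _ => Submodule.sum_mem _ fun x' _ =>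
    Submodule.smul_mem _ _ (Submodule.subset_span ⟨(x', x), rfl⟩))

/-- If `id ⊗ L` fixes `ω`, then `L` fixes every `Y`-block of `ω`, and these span. -/
theorem isComplete_of_isCompleteStateSpace [DecidableEq X] [DecidableEq Y]
    {ω : QInfoStructure X Y} (h : IsCompleteStateSpace ω.localStateSpace) : ω.IsComplete := by
  refine ⟨h, fun L => ⟨fun hL => ?_, fun hL => by rw [hL]; rfl⟩⟩
  refine LinearMap.ext_on_range (span_rightBlock_eq_top h) fun p => ?_
  rw [← rightBlock_idTensor, hL, LinearMap.id_apply]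

end QInfoStructure

/-! ### Unitary operator bases and vectorisation -/

/-- An orthogonal basis of operators consisting of unitaries (clock and shift matrices). -/
theorem exists_unitary_basis {Y B : Type*} [Fintype Y] [Fintype B] [DecidableEq Y] [DecidableEq B]
    [Nonempty B] (h : Fintype.card Y = Fintype.card B) :
    ∃ U : B × B → Matrix Y B ℂ, (∀ i, (U i)ᴴ * U i = 1) ∧ (∀ i, U i * (U i)ᴴ = 1) ∧
      ∀ y b y' b', ∑ i, U i y b * star (U i y' b')
        = if y = y' ∧ b = b' then (Fintype.card B : ℂ) else 0 := by
  set d := Fintype.card B with hd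
  have : NeZero d := ⟨Fintype.card_ne_zero⟩
  let e : B ≃ ZMod d := Fintype.equivOfCardEq (by rw [ZMod.card])
  let f : Y ≃ ZMod d := Fintype.equivOfCardEq (by rw [ZMod.card, h])
  let ψ : AddChar (ZMod d) ℂ := ZMod.stdAddChar
  have hψ : ψ.IsPrimitive := ZMod.isPrimitive_stdAddChar d
  have hc : ∀ x, star (ψ x) = ψ (-x) := fun x => (AddChar.map_neg_eq_conj ψ x).symm
  -- `V a t` is a shift by `a` after a clock of frequency `t`. In the completeness relation the
  -- positions of the entries determine `a`, and the sum over `t` is a character sum.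
  let V : ZMod d → ZMod d → Matrix (ZMod d) (ZMod d) ℂ := fun a t =>
    Matrix.of fun k l => if k = l + a then ψ (t * l) else 0
  have hV : ∀ a t, (V a t)ᴴ * V a t = 1 := fun a t => by
    ext k l
    simp only [V, Matrix.mul_apply, conjTranspose_apply, Matrix.of_apply, Matrix.one_apply,
      apply_ite star, hc, star_zero, mul_ite, mul_zero, Finset.sum_ite_eq', Finset.mem_univ,
      if_true, add_left_inj, @eq_comm _ l k]
    split_ifs with hkl
    · rw [hkl, ← AddChar.map_add_eq_mul, neg_add_cancel, AddChar.map_zero_eq_one]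
    · simp
  refine ⟨fun i => (V (e i.1) (e i.2)).submatrix f e, fun i => ?_, fun i => ?_, ?_⟩
  · rw [conjTranspose_submatrix, submatrix_mul_equiv, hV, submatrix_one_equiv]
  · rw [conjTranspose_submatrix, submatrix_mul_equiv, mul_eq_one_comm.mp (hV _ _),
      submatrix_one_equiv]
  · intro y b y' b'
    have h1 : ∀ k k' l l' : ZMod d, ∑ a, ∑ t, V a t k k' * star (V a t l l')
        = if k = l ∧ k' = l' then (d : ℂ) else 0 := fun k k' l l' => by
      have h2 : ∀ a, ∑ t, V a t k k' * star (V a t l l')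
          = if a = k - k' then (if a = l - l' then (if k' = l' then (d : ℂ) else 0) else 0)
            else 0 := fun a => by
        have h3 := AddChar.sum_mulShift (k' - l') hψ
        rw [ZMod.card] at h3
        by_cases h4 : a = k - k'
        · by_cases h5 : a = l - l'
          · have e1 : k = k' + a := by rw [h4]; ring
            have e2 : l = l' + a := by rw [h5]; ring
            simp only [V, Matrix.of_apply, if_pos e1, if_pos e2, if_pos h4, if_pos h5, hc,
              ← AddChar.map_add_eq_mul]
            simp only [sub_eq_zero] at h3
            push_cast at h3
            rw [← h3]
            refine Finset.sum_congr rfl fun t _ => ?_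
            congr 1
            ring
          · have e2 : ¬ l = l' + a := fun h => h5 (by rw [h]; ring)
            simp [V, e2, h5]
        · have e1 : ¬ k = k' + a := fun h => h4 (by rw [h]; ring)
          simp [V, e1, h4]
      simp only [h2, Finset.sum_ite_eq', Finset.mem_univ, if_true]
      by_cases h6 : k' = l'
      · simp [h6]
      · simp [h6]
    rw [Fintype.sum_prod_type, ← Equiv.sum_comp e.symm]
    conv_lhs =>
      enter [2, x]
      rw [← Equiv.sum_comp e.symm]
    simp only [Equiv.apply_symm_apply, submatrix_apply, h1, f.injective.eq_iff, e.injective.eq_iff]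

theorem trace_vecMulVec_mul_kronecker {Y B : Type*} [Fintype Y] [Fintype B] (U : Matrix Y B ℂ)
    (τ : Matrix Y Y ℂ) (s : Matrix B B ℂ) :
    (vecMulVec (fun p : Y × B => U p.1 p.2) (star fun p : Y × B => U p.1 p.2) * (τ ⊗ₖ s)).trace
      = (Uᴴ * τ * U * sᵀ).trace := by
  rw [vecMulVec_mul, trace_vecMulVec, dotProduct_comm, ← dotProduct_mulVec]
  simp only [dotProduct, mulVec, Matrix.trace, Matrix.diag, Matrix.mul_apply, Fintype.sum_prod_type,
    Pi.star_apply, kronecker_apply, conjTranspose_apply, transpose_apply, Finset.mul_sum,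
    Finset.sum_mul]
  rw [Finset.sum_comm]
  refine Finset.sum_congr rfl fun b _ => ?_
  conv_rhs =>
    enter [2, c]
    rw [Finset.sum_comm]
  conv_lhs =>
    enter [2, y]
    rw [Finset.sum_comm]
  rw [Finset.sum_comm]
  conv_rhs =>
    enter [2, c]
    rw [Finset.sum_comm]
  refine Finset.sum_congr rfl fun c _ => ?_
  rw [Finset.sum_comm]
  exact Finset.sum_congr rfl fun y _ => Finset.sum_congr rfl fun y' _ => by ring

/-- Each row of `R`, reshaped into a `C × B` matrix, acts as a Kraus operator. -/
theorem trace_mul_single_kronecker {K C B : Type*} [Fintype K] [Fintype C] [Fintype B]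
    [DecidableEq C] (R : Matrix K (C × B) ℂ) (M : Matrix B B ℂ) (c' c : C) :
    (R * (Matrix.single c' c 1 ⊗ₖ M) * Rᴴ).trace
      = ∑ k, conjLinear (Matrix.of fun c b => R k (c, b)) M c' c := by
  simp [Matrix.trace, Matrix.mul_apply, Fintype.sum_prod_type, conjLinear, Matrix.single_apply,
    ite_and, Finset.sum_mul, mul_assoc]

theorem partialTraceLeft_conj_unitary {Y C B : Type*} [Fintype Y] [Fintype C] [Fintype B]
    [DecidableEq Y] [DecidableEq B] {U : Matrix Y C ℂ} (hU : U * Uᴴ = 1)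
    (Q : Matrix (Y × B) (Y × B) ℂ) :
    partialTraceLeft ((U ⊗ₖ (1 : Matrix B B ℂ))ᴴ * Q * (U ⊗ₖ (1 : Matrix B B ℂ)))
      = partialTraceLeft Q := by
  have h : ∀ y y', ∑ c, U y c * star (U y' c) = if y = y' then 1 else 0 := fun y y' => by
    have := congrFun (congrFun hU y) y'
    rwa [Matrix.mul_apply, Matrix.one_apply] at this
  ext b b'
  simp only [partialTraceLeft, Matrix.mul_apply, Fintype.sum_prod_type, Matrix.of_apply,
    conjTranspose_apply, kronecker_apply, Matrix.one_apply, mul_ite, mul_one, mul_zero,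
    Finset.sum_ite_eq', Finset.mem_univ, if_true, apply_ite star, star_zero,
    ite_mul, zero_mul, Finset.sum_mul]
  have h2 : ∀ y y', ∑ c, star (U y' c) * Q (y', b) (y, b') * U y c
      = if y = y' then Q (y', b) (y, b') else 0 := fun y y' => by
    have h3 : ∑ c, star (U y' c) * Q (y', b) (y, b') * U y c
        = (∑ c, U y c * star (U y' c)) * Q (y', b) (y, b') := by
      rw [Finset.sum_mul]
      exact Finset.sum_congr rfl fun c _ => by ring
    rw [h3, h, ite_mul, one_mul, zero_mul]
  rw [Finset.sum_comm]
  refine Finset.sum_congr rfl fun y _ => ?_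
  have h4 : ∑ c, ∑ y', star (U y' c) * Q (y', b) (y, b') * U y c = Q (y, b) (y, b') := by
    rw [Finset.sum_comm]
    simp only [h2]
    simp
  rw [Finset.sum_comm]
  simpa using h4

/-! ### The teleportation argument: from informativeness to a channel -/

namespace QInfoStructure

variable {A B B' X Y : Type u} [Fintype A] [Fintype B] [Fintype B'] [Fintype X] [Fintype Y]

theorem exists_trace_eq_of_comp_moreInformative [DecidableEq B] [DecidableEq B'] [DecidableEq Y]
    {ω : QInfoStructure X Y}
    (hω : Submodule.span ℂ (Set.range fun p : X × X => rightBlock ω.state p.1 p.2) = ⊤)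
    {ρ : QInfoStructure A B} {σ : QInfoStructure A B'}
    (h : (ω.comp ρ).MoreInformative (ω.comp σ)) {I : Type u} [Fintype I] [Nonempty I]
    (P : POVM I (Y × B')) :
    ∃ Q : POVM I (Y × B), ∀ i τ a a', (P.elem i * (τ ⊗ₖ rightBlock σ.state a a')).trace
      = (Q.elem i * (τ ⊗ₖ rightBlock ρ.state a a')).trace := by
  obtain ⟨Q, hQ⟩ := h.exists_povm P
  refine ⟨Q, fun i τ a a' => ?_⟩
  have hτ : τ ∈ Submodule.span ℂ (Set.range fun p : X × X => rightBlock ω.state p.1 p.2) := by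
    rw [hω]
    trivial
  induction hτ using Submodule.span_induction with
  | mem τ hτ =>
    obtain ⟨⟨x, x'⟩, rfl⟩ := hτ
    exact hQ i (x, a) (x', a')
  | zero => simp
  | add τ τ' _ _ h1 h2 => simp only [add_kronecker, Matrix.mul_add, trace_add, h1, h2]
  | smul c τ _ h1 => simp only [smul_kronecker, Matrix.mul_smul, trace_smul, h1]

/-- The POVM of rank-one operators associated with a unitary operator basis. -/
noncomputable def _root_.POVM.ofUnitaryBasis {Y B : Type u} [Fintype Y] [Fintype B]
    [DecidableEq Y] [DecidableEq B] [Nonempty B] (U : B × B → Matrix Y B ℂ)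
    (hU : ∀ y b y' b', ∑ i, U i y b * star (U i y' b')
      = if y = y' ∧ b = b' then (Fintype.card B : ℂ) else 0) : POVM (B × B) (Y × B) where
  elem i := (Fintype.card B : ℂ)⁻¹ •
    vecMulVec (fun p : Y × B => U i p.1 p.2) (star fun p : Y × B => U i p.1 p.2)
  posSemidef i := (posSemidef_vecMulVec_self_star _).smul (by positivity)
  sum_eq_one := by
    ext p q
    have hd : (Fintype.card B : ℂ) ≠ 0 := by simp
    have := hU p.1 p.2 q.1 q.2
    simp only [Matrix.sum_apply, Matrix.smul_apply, vecMulVec_apply, Pi.star_apply, smul_eq_mul,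
      ← Finset.mul_sum, this, Matrix.one_apply, Prod.ext_iff, mul_ite, mul_zero,
      inv_mul_cancel₀ hd]

theorem sufficient_of_comp_moreInformative [DecidableEq B] [DecidableEq B'] [DecidableEq Y]
    {ω : QInfoStructure X Y} (hcard : Fintype.card Y = Fintype.card B')
    (hω : Submodule.span ℂ (Set.range fun p : X × X => rightBlock ω.state p.1 p.2) = ⊤)
    {ρ : QInfoStructure A B} {σ : QInfoStructure A B'} [Nonempty B']
    (h : (ω.comp ρ).MoreInformative (ω.comp σ)) : ρ.Sufficient σ := by
  obtain ⟨U, hU₁, hU₂, hU⟩ := exists_unitary_basis (Y := Y) (B := B') hcard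
  obtain ⟨Q, hQ⟩ := exists_trace_eq_of_comp_moreInformative hω h (POVM.ofUnitaryBasis U hU)
  choose R hR using fun i => (Q.posSemidef i).exists_eq_conjTranspose_mul_self
  set d := Fintype.card B' with hd
  have hd0 : (d : ℝ) ≠ 0 := by simp [hd]
  let r : ℝ := (Real.sqrt d)⁻¹
  have hr : r * r = (d : ℝ)⁻¹ := by
    rw [← mul_inv, Real.mul_self_sqrt (Nat.cast_nonneg d)]
  -- Absorbing `U i` into the factor of `Q i` performs the teleportation correction. The rows of `T
  -- i` become Kraus operators, and `r = d^(-1/2)` makes the whole family trace-preserving.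
  let T : B' × B' → Matrix (Y × B) (B' × B) ℂ := fun i => R i * (U i ⊗ₖ (1 : Matrix B B ℂ))
  let K' : (B' × B') × (Y × B) → Matrix B' B ℂ := fun j => Matrix.of fun c b => T j.1 j.2 (c, b)
  let K : (B' × B') × (Y × B) → Matrix B' B ℂ := fun j => r • K' j
  have hT : ∀ i, (T i)ᴴ * T i
      = (U i ⊗ₖ (1 : Matrix B B ℂ))ᴴ * Q.elem i * (U i ⊗ₖ (1 : Matrix B B ℂ)) := fun i => by
    simp only [T, conjTranspose_mul, hR, Matrix.mul_assoc]
  have hK' : ∑ j, (K' j)ᴴ * K' j = (d : ℝ) • (1 : Matrix B B ℂ) := by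
    have h1 : ∀ i, ∑ k, (K' (i, k))ᴴ * K' (i, k) = partialTraceLeft (Q.elem i) := fun i => by
      rw [← partialTraceLeft_conj_unitary (hU₂ i), ← hT]
      ext b b'
      simp only [K', Matrix.sum_apply, Matrix.mul_apply, conjTranspose_apply, Matrix.of_apply,
        partialTraceLeft]
      exact Finset.sum_comm
    rw [Fintype.sum_prod_type]
    simp only [h1]
    have h2 : ∑ i, partialTraceLeft (Q.elem i) = partialTraceLeft (∑ i, Q.elem i) := by
      ext b b'
      simp only [Matrix.sum_apply, partialTraceLeft, Matrix.of_apply]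
      exact Finset.sum_comm
    rw [h2, Q.sum_eq_one]
    ext b b'
    by_cases hb : b = b' <;> simp [partialTraceLeft, Matrix.one_apply, hb, hcard]
  refine ⟨∑ j, conjLinear (K j), isCPTP_sum_conjLinear K ?_, ext_rightBlock fun a a' => ?_⟩
  · simp only [K, conjTranspose_smul, star_trivial, Matrix.smul_mul, Matrix.mul_smul, smul_smul, hr]
    rw [← Finset.smul_sum, hK', smul_smul, inv_mul_cancel₀ hd0, one_smul]
  · rw [rightBlock_idTensor]
    ext c' c
    -- Taking `τ = U i * single c' c 1 * (U i)ᴴ` undoes `U i` on the Bell side and isolates one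
    -- entry of the block of `σ`. Each of the `d²` outcomes contributes `d⁻¹` of it; the factor `r²`
    -- supplies the other `d⁻¹`.
    have h1 : ∀ i, ∑ k, conjLinear (K' (i, k)) (rightBlock ρ.state a a') c' c
        = (d : ℂ)⁻¹ * rightBlock σ.state a a' c' c := fun i => by
      refine (trace_mul_single_kronecker (T i) (rightBlock ρ.state a a') c' c).symm.trans ?_
      have h2 := hQ i (U i * Matrix.single c' c (1 : ℂ) * (U i)ᴴ) a a'
      have h3 : (U i * Matrix.single c' c (1 : ℂ) * (U i)ᴴ) ⊗ₖ rightBlock ρ.state a a'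
          = (U i ⊗ₖ (1 : Matrix B B ℂ)) * (Matrix.single c' c (1 : ℂ) ⊗ₖ rightBlock ρ.state a a')
            * (U i ⊗ₖ (1 : Matrix B B ℂ))ᴴ := by
        rw [conjTranspose_kronecker, ← mul_kronecker_mul, ← mul_kronecker_mul]
        simp
      have h4 : (U i)ᴴ * (U i * Matrix.single c' c (1 : ℂ) * (U i)ᴴ) * U i = Matrix.single c' c (1 : ℂ) := by
        rw [Matrix.mul_assoc (U i), ← Matrix.mul_assoc, hU₁, Matrix.one_mul, Matrix.mul_assoc,
          hU₁, Matrix.mul_one]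
      have h5 : (Matrix.single c' c (1 : ℂ) * (rightBlock σ.state a a')ᵀ).trace
          = rightBlock σ.state a a' c' c := by
        simp [Matrix.trace, Matrix.mul_apply, Matrix.single_apply, ite_and]
      rw [POVM.ofUnitaryBasis, Matrix.smul_mul, trace_smul, trace_vecMulVec_mul_kronecker, h4, h5,
        h3, hR i] at h2
      rw [← smul_eq_mul, h2, trace_mul_comm, ← Matrix.mul_assoc, trace_mul_comm]
      simp only [T, conjTranspose_mul, Matrix.mul_assoc]
      rw [← Matrix.mul_assoc, trace_mul_comm]
      simp only [Matrix.mul_assoc]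
    have h6 : ∀ j, conjLinear (K j) (rightBlock ρ.state a a')
        = (d : ℝ)⁻¹ • conjLinear (K' j) (rightBlock ρ.state a a') := fun j => by
      simp only [K, conjLinear, LinearMap.coe_mk, AddHom.coe_mk, conjTranspose_smul, star_trivial,
        Matrix.smul_mul, Matrix.mul_smul, smul_smul, hr]
    rw [LinearMap.sum_apply, Matrix.sum_apply]
    simp only [h6, Matrix.smul_apply]
    rw [← Finset.smul_sum, Fintype.sum_prod_type]
    have hd1 : (d : ℂ) ≠ 0 := by exact_mod_cast hd0
    simp only [h1, Finset.sum_const, Finset.card_univ, Fintype.card_prod, ← hd]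
    simp only [nsmul_eq_mul, Complex.real_smul]
    push_cast
    field_simp

end QInfoStructure

/-! ### Normalisation, maximally entangled states and completeness of isotropic states -/

theorem IsDensityMatrix.nonempty {A : Type*} [Fintype A] {N : Matrix A A ℂ}
    (hN : IsDensityMatrix N) : Nonempty A := by
  by_contra h
  rw [not_nonempty_iff] at h
  have := hN.2
  simp [Matrix.trace] at this

theorem IsDensityMatrix.posSemidef_one_sub {A : Type*} [Fintype A] [DecidableEq A]
    {N : Matrix A A ℂ} (hN : IsDensityMatrix N) : (1 - N).PosSemidef := by
  have hH := hN.1.isHermitian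
  have hsum : ∑ i, hH.eigenvalues i = 1 := by
    have := hH.trace_eq_sum_eigenvalues
    rw [hN.2] at this
    simpa using (congrArg Complex.re this).symm
  have hle : ∀ i, hH.eigenvalues i ≤ 1 := fun i => by
    rw [← hsum]
    exact Finset.single_le_sum (fun j _ => hN.1.eigenvalues_nonneg j) (Finset.mem_univ i)
  let V : Matrix A A ℂ := hH.eigenvectorUnitary
  have hV : V * Vᴴ = 1 := Unitary.coe_mul_star_self hH.eigenvectorUnitary
  have hspec : N = V * diagonal (RCLike.ofReal ∘ hH.eigenvalues) * Vᴴ := by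
    conv_lhs => rw [hH.spectral_theorem]
    rfl
  have h1 : 1 - N = V * (1 - diagonal (RCLike.ofReal ∘ hH.eigenvalues)) * Vᴴ := by
    rw [Matrix.mul_sub, Matrix.sub_mul, ← hspec, Matrix.mul_one, hV]
  rw [h1]
  refine PosSemidef.mul_mul_conjTranspose_same ?_ V
  rw [← diagonal_one, diagonal_sub, posSemidef_diagonal_iff]
  intro i
  have : (0 : ℝ) ≤ 1 - hH.eigenvalues i := by linarith [hle i]
  simpa using (show (0 : ℂ) ≤ ((1 - hH.eigenvalues i : ℝ) : ℂ) by exact_mod_cast this)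

theorem isDensityMatrix_inv_card_smul_one (A : Type*) [Fintype A] [DecidableEq A] [Nonempty A] :
    IsDensityMatrix ((Fintype.card A : ℂ)⁻¹ • (1 : Matrix A A ℂ)) :=
  ⟨PosSemidef.one.smul (by positivity), by simp [trace_smul]⟩

/-- A positive semidefinite matrix of trace zero vanishes, so any density matrix serves there; the
maximally mixed one is taken. -/
theorem Matrix.PosSemidef.exists_eq_trace_smul {A : Type*} [Fintype A] [Nonempty A]
    {M : Matrix A A ℂ} (hM : M.PosSemidef) : ∃ α, IsDensityMatrix α ∧ M = M.trace • α := by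
  classical
  by_cases ht : M.trace = 0
  · exact ⟨_, isDensityMatrix_inv_card_smul_one A, by rw [ht, zero_smul, hM.trace_eq_zero_iff.mp ht]⟩
  · refine ⟨M.trace⁻¹ • M, ⟨hM.smul (inv_nonneg.mpr hM.trace_nonneg), ?_⟩, ?_⟩
    · rw [trace_smul, smul_eq_mul, inv_mul_cancel₀ ht]
    · rw [smul_smul, mul_inv_cancel₀ ht, one_smul]

theorem IsCompleteStateSpace.mono {B : Type*} [Fintype B] {S T : Set (Matrix B B ℂ)}
    (h : IsCompleteStateSpace S) (hST : S ⊆ T) : IsCompleteStateSpace T := by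
  obtain ⟨f, hf, hli⟩ := h
  exact ⟨f, fun i => ⟨hST (hf i).1, (hf i).2⟩, hli⟩

namespace QInfoStructure

variable {X Y : Type u} [Fintype X] [Fintype Y]

theorem isSeparable_of_sum (ω : QInfoStructure X Y) {ι : Type*} [Fintype ι]
    (S : ι → Matrix X X ℂ) (T : ι → Matrix Y Y ℂ) (hS : ∀ i, (S i).PosSemidef)
    (hT : ∀ i, (T i).PosSemidef) (h : ω.state = ∑ i, S i ⊗ₖ T i) : ω.IsSeparable := by
  obtain ⟨x, y⟩ := ω.isDensityMatrix.nonempty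
  have : Nonempty X := ⟨x⟩
  have : Nonempty Y := ⟨y⟩
  choose α hα hSα using fun i => (hS i).exists_eq_trace_smul
  choose β hβ hTβ using fun i => (hT i).exists_eq_trace_smul
  have hre : ∀ i, (S i).trace * (T i).trace = (((S i).trace * (T i).trace).re : ℂ) := fun i => by
    have := Complex.le_def.mp (mul_nonneg (hS i).trace_nonneg (hT i).trace_nonneg)
    exact Complex.ext (by simp) (by simpa using this.2.symm)
  let e := (Fintype.equivFin ι).symm
  refine ⟨Fintype.card ι, fun j => ((S (e j)).trace * (T (e j)).trace).re, fun j => α (e j),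
    fun j => β (e j), fun j => ⟨?_, hα _, hβ _⟩, ?_, ?_⟩
  · exact (Complex.le_def.mp (mul_nonneg (hS _).trace_nonneg (hT _).trace_nonneg)).1
  · have h1 := ω.isDensityMatrix.2
    rw [h, trace_sum] at h1
    simp only [trace_kronecker] at h1
    rw [e.sum_comp fun i => ((S i).trace * (T i).trace).re, ← Complex.re_sum, h1, Complex.one_re]
  · rw [h, ← e.sum_comp]
    refine Finset.sum_congr rfl fun j _ => ?_
    rw [← hre]
    conv_lhs => rw [hSα, hTβ, smul_kronecker, kronecker_smul, smul_smul]

/-- With the two bases as columns of `E` and `F`, the coefficient matrix of `ψ` is `E * Fᵀ` up to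
`d^(-1/2)`. -/
theorem IsMaximallyEntangled.exists_unitary [DecidableEq X] [DecidableEq Y]
    {Ψ : QInfoStructure X Y} (h : Ψ.IsMaximallyEntangled) :
    Fintype.card X = Fintype.card Y ∧ ∃ (E : Matrix X Y ℂ) (F : Matrix Y Y ℂ),
      Eᴴ * E = 1 ∧ E * Eᴴ = 1 ∧ Fᴴ * F = 1 ∧ F * Fᴴ = 1 ∧
      Ψ.state = (Fintype.card Y : ℂ)⁻¹ • vecMulVec (fun p : X × Y => (E * Fᵀ) p.1 p.2)
        (star fun p : X × Y => (E * Fᵀ) p.1 p.2) := by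
  obtain ⟨e, f, ψ, hψ, hΨ⟩ := h
  have hcard : Fintype.card X = Fintype.card Y := by
    have := Module.finrank_eq_card_basis e.toBasis
    rwa [finrank_euclideanSpace] at this
  have horth : ∀ {Z : Type u} [Fintype Z] (g : OrthonormalBasis Y ℂ (EuclideanSpace ℂ Z)),
      (Matrix.of fun z k => g k z)ᴴ * (Matrix.of fun z k => g k z) = 1 := by
    intro Z _ g
    ext k l
    have := orthonormal_iff_ite.mp g.orthonormal k l
    rw [EuclideanSpace.inner_eq_star_dotProduct, dotProduct_comm] at this
    rw [Matrix.one_apply, ← this]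
    rfl
  refine ⟨hcard, Matrix.of fun x k => e k x, Matrix.of fun y k => f k y, horth e, ?_, horth f,
    mul_eq_one_comm.mp (horth f), ?_⟩
  · exact (mul_eq_one_comm_of_card_eq _ _ _ hcard.symm).mp (horth e)
  · have hr : (((Real.sqrt (Fintype.card Y))⁻¹ : ℝ) : ℂ) * (((Real.sqrt (Fintype.card Y))⁻¹ : ℝ) : ℂ)
        = (Fintype.card Y : ℂ)⁻¹ := by
      rw [← Complex.ofReal_mul, ← mul_inv, Real.mul_self_sqrt (Nat.cast_nonneg _)]
      push_cast
      rfl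
    rw [hΨ]
    ext ⟨x, y⟩ ⟨x', y'⟩
    simp only [vecMulVec_apply, Pi.star_apply, hψ, Matrix.smul_apply, smul_eq_mul, ← hr,
      Matrix.mul_apply, transpose_apply, Matrix.of_apply, star_mul', RCLike.star_def,
      Complex.conj_ofReal]
    ring

theorem IsMaximallyEntangled.isComplete_isotropic [DecidableEq X] [DecidableEq Y]
    {Ψ : QInfoStructure X Y} (h : Ψ.IsMaximallyEntangled) {p : ℝ} (hp : p ∈ Set.Icc (0 : ℝ) 1)
    (hp0 : p ≠ 0) : (Ψ.isotropic p hp).IsComplete := by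
  apply isComplete_of_isCompleteStateSpace
  obtain ⟨hcard, E, F, hE, hE', hF, hF', hΨ⟩ := h.exists_unitary
  obtain ⟨-, y⟩ := Ψ.isDensityMatrix.nonempty
  have : Nonempty Y := ⟨y⟩
  set d := Fintype.card Y with hd
  have hd0 : (d : ℂ) ≠ 0 := by simp [hd]
  set W := E * Fᵀ with hWdef
  have hFt : Fᵀ * Fᵀᴴ = 1 := by
    have h1 : Fᵀ * Fᵀᴴ = (Fᴴ * F)ᵀ := (transpose_mul Fᴴ F).symm
    rw [h1, hF, transpose_one]
  have hFt' : Fᵀᴴ * Fᵀ = 1 := mul_eq_one_comm.mp hFt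
  have hW : Wᴴ * W = 1 := by
    rw [hWdef, conjTranspose_mul, Matrix.mul_assoc, ← Matrix.mul_assoc Eᴴ, hE, Matrix.one_mul, hFt']
  have hW' : W * Wᴴ = 1 := by
    rw [hWdef, conjTranspose_mul, Matrix.mul_assoc, ← Matrix.mul_assoc Fᵀ, hFt, Matrix.one_mul, hE']
  have hp0' : (p : ℂ) ≠ 0 := by exact_mod_cast hp0
  let q : ℂ := (1 - p) / d
  -- `Λ` sends the state steered from `Ψ` to the one steered from the isotropic mixture. It
  -- preserves the trace, so its kernel is traceless, where it is multiplication by `p ≠ 0`.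
  let Λ : Matrix Y Y ℂ →ₗ[ℂ] Matrix Y Y ℂ :=
    (p : ℂ) • LinearMap.id + q • (traceLinearMap Y ℂ ℂ).smulRight (1 : Matrix Y Y ℂ)
  have hΛ : ∀ N, Λ N = (p : ℂ) • N + q • N.trace • (1 : Matrix Y Y ℂ) := fun N => rfl
  have htr : ∀ N, (Λ N).trace = N.trace := fun N => by
    rw [hΛ, trace_add, trace_smul, trace_smul, trace_smul, trace_one]
    simp only [smul_eq_mul, q, ← hd]
    field_simp
    ring
  have hinj : Function.Injective Λ := by
    rw [injective_iff_map_eq_zero]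
    intro N hN
    have h1 := htr N
    rw [hN, trace_zero] at h1
    rw [hΛ, ← h1, zero_smul, smul_zero, add_zero] at hN
    exact (smul_eq_zero.mp hN).resolve_left hp0'
  have hq : 0 ≤ q := by
    have : (0 : ℝ) ≤ (1 - p) / d := div_nonneg (by linarith [hp.2]) (by positivity)
    have h1 : q = (((1 - p) / d : ℝ) : ℂ) := by
      simp only [q]
      push_cast
      rfl
    rw [h1]
    exact_mod_cast this
  have hdens : ∀ N, IsDensityMatrix N → IsDensityMatrix (Λ N) := fun N hN => by
    refine ⟨?_, by rw [htr, hN.2]⟩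
    rw [hΛ, hN.2, one_smul]
    exact (hN.1.smul (by exact_mod_cast hp.1)).add (PosSemidef.one.smul hq)
  have hspan : Submodule.span ℂ (Λ '' {N | IsDensityMatrix N}) = ⊤ := by
    rw [← Submodule.map_span, span_isDensityMatrix, Submodule.map_top, LinearMap.range_eq_top]
    exact LinearMap.injective_iff_surjective.mp hinj
  refine (isCompleteStateSpace_of_span_eq_top ?_ hspan).mono ?_
  · rintro _ ⟨N, hN, rfl⟩
    exact hdens N hN
  rintro _ ⟨N, hN, rfl⟩
  have hN : IsDensityMatrix N := hN
  -- Measuring `P` on `Ψ` leaves `d⁻¹ (Wᴴ P W)ᵀ` on `Y`; this choice makes it `d⁻¹ N`.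
  let P : Matrix X X ℂ := W * Nᵀ * Wᴴ
  have hPtr : P.trace = 1 := by
    rw [trace_mul_comm, ← Matrix.mul_assoc, hW, Matrix.one_mul, trace_transpose, hN.2]
  have hWP : Wᴴ * P * W = Nᵀ := by
    simp only [P, Matrix.mul_assoc, hW, Matrix.mul_one]
    rw [← Matrix.mul_assoc, hW, Matrix.one_mul]
  have hpt : partialTraceLeft ((P ⊗ₖ (1 : Matrix Y Y ℂ)) * (Ψ.isotropic p hp).state)
      = (d : ℂ)⁻¹ • Λ N := by
    rw [partialTraceLeft_kronecker_one_mul]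
    ext y y'
    have h1 : N y y' = ∑ x, ∑ x', P x x' * (W x' y * star (W x y')) := by
      rw [← transpose_apply N, ← hWP]
      simp only [Matrix.mul_apply, conjTranspose_apply, Finset.sum_mul]
      rw [Finset.sum_comm]
      refine Finset.sum_congr rfl fun x _ => Finset.sum_congr rfl fun x' _ => by ring
    have h2 : ∀ x x', (P x x' • rightBlock (Ψ.isotropic p hp).state x' x) y y'
        = (d : ℂ)⁻¹ * p * (P x x' * (W x' y * star (W x y')))
          + if x = x' then (d : ℂ)⁻¹ * q * (1 : Matrix Y Y ℂ) y y' * P x x' else 0 := fun x x' => by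
      have h3 : (1 : Matrix (X × Y) (X × Y) ℂ) (x', y) (x, y')
          = if x = x' then (1 : Matrix Y Y ℂ) y y' else 0 := by
        by_cases hx : x = x'
        · by_cases hy : y = y' <;> simp [Matrix.one_apply, hx, hy]
        · simp [hx, Ne.symm hx]
      simp only [rightBlock, Matrix.smul_apply, Matrix.of_apply, isotropic, Matrix.add_apply, hΨ,
        vecMulVec_apply, Pi.star_apply, smul_eq_mul, h3, hcard, ← hd, q]
      split_ifs
      · push_cast
        field_simp
      · ring
    simp only [Matrix.sum_apply, h2, Finset.sum_add_distrib, ← Finset.mul_sum, ← h1,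
      Finset.sum_ite_eq, Finset.mem_univ, if_true]
    have h4 : ∑ x, P x x = 1 := hPtr
    rw [h4, hΛ, hN.2, one_smul]
    simp only [Matrix.smul_apply, Matrix.add_apply, smul_eq_mul]
    ring
  have htr2 : ((P ⊗ₖ (1 : Matrix Y Y ℂ)) * (Ψ.isotropic p hp).state).trace = (d : ℂ)⁻¹ := by
    rw [← trace_partialTraceLeft, hpt, trace_smul, htr, hN.2, smul_eq_mul, mul_one]
  refine ⟨P, hN.1.transpose.mul_mul_conjTranspose_same W, ?_, ?_, ?_⟩
  · have h1 : 1 - P = W * (1 - N)ᵀ * Wᴴ := by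
      rw [transpose_sub, transpose_one, Matrix.mul_sub, Matrix.sub_mul, Matrix.mul_one, hW']
    rw [h1]
    exact hN.posSemidef_one_sub.transpose.mul_mul_conjTranspose_same W
  · rw [htr2]
    exact inv_ne_zero hd0
  · rw [htr2, hpt, inv_inv, smul_smul, mul_inv_cancel₀ hd0, one_smul]

end QInfoStructure

/-! ### Separability of isotropic states by averaging over characters -/

/-- Modulo 3 a doubled basis vector stays visible; modulo 2 there would be the spurious solution `k
= l'`, `l = k'`. -/
theorem single_add_single_eq_iff {Y : Type*} [DecidableEq Y] (k k' l l' : Y) :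
    (Pi.single k 1 + Pi.single l' 1 : Y → ZMod 3) = Pi.single l 1 + Pi.single k' 1 ↔
      (k = l ∧ k' = l') ∨ (k = k' ∧ l = l') := by
  constructor
  · intro h
    have h0 : (1 : ZMod 3) ≠ 0 := by decide
    have h1 : (1 + 1 : ZMod 3) ≠ 0 := by decide
    have h2 : (1 + 1 : ZMod 3) ≠ 1 := by decide
    have hk := congrFun h k
    have hl := congrFun h l
    have hl' := congrFun h l'
    simp only [Pi.add_apply, Pi.single_apply] at hk hl hl'
    grind
  · rintro (⟨rfl, rfl⟩ | ⟨rfl, rfl⟩)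
    · rfl
    · exact add_comm _ _

/-- Orthogonality of characters leaves the entries with `k = l, k' = l'` (the identity) or `k = k',
l = l'` (the entangled term). The diagonal sum compensates for their overlap, which the average
counts only once. -/
theorem sum_addChar_kronecker (Y : Type*) [Fintype Y] [DecidableEq Y] :
    ∑ ψ : AddChar (Y → ZMod 3) ℂ,
        vecMulVec (fun k => ψ (Pi.single k 1)) (star fun k => ψ (Pi.single k 1)) ⊗ₖ
          vecMulVec (star fun k => ψ (Pi.single k 1)) (fun k => ψ (Pi.single k 1))
      + (Fintype.card (Y → ZMod 3) : ℂ) • ∑ k : Y, Matrix.single k k 1 ⊗ₖ Matrix.single k k 1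
    = (Fintype.card (Y → ZMod 3) : ℂ) • (1 + vecMulVec (fun p : Y × Y => if p.1 = p.2 then 1 else 0)
        (fun p : Y × Y => if p.1 = p.2 then 1 else 0)) := by
  ext ⟨k, k'⟩ ⟨l, l'⟩
  have h1 : ∀ ψ : AddChar (Y → ZMod 3) ℂ, ψ (Pi.single k 1) * star (ψ (Pi.single l 1))
      * (star (ψ (Pi.single k' 1)) * ψ (Pi.single l' 1))
      = ψ ((Pi.single k 1 + Pi.single l' 1) - (Pi.single l 1 + Pi.single k' 1)) := fun ψ => by
    rw [RCLike.star_def, ← AddChar.map_neg_eq_conj, ← AddChar.map_neg_eq_conj,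
      ← AddChar.map_add_eq_mul, ← AddChar.map_add_eq_mul, ← AddChar.map_add_eq_mul]
    congr 1
    abel
  simp only [Matrix.add_apply, Matrix.sum_apply, Matrix.smul_apply, kronecker_apply,
    vecMulVec_apply, Pi.star_apply, h1, AddChar.sum_apply_eq_ite, sub_eq_zero,
    single_add_single_eq_iff, Matrix.single_apply, Matrix.one_apply, smul_eq_mul, Prod.mk.injEq]
  have h2 : ∑ x : Y, ((if x = k ∧ x = l then (1 : ℂ) else 0) * if x = k' ∧ x = l' then 1 else 0)
      = if k = l ∧ k = k' ∧ k = l' then 1 else 0 := by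
    have : ∀ x : Y, ((if x = k ∧ x = l then (1 : ℂ) else 0) * if x = k' ∧ x = l' then 1 else 0)
        = if x = k then (if k = l ∧ k = k' ∧ k = l' then 1 else 0) else 0 := fun x => by
      grind
    simp [this]
  rw [h2]
  generalize (Fintype.card (Y → ZMod 3) : ℂ) = N
  clear h1 h2
  grind

namespace QInfoStructure

variable {X Y : Type u} [Fintype X] [Fintype Y]

theorem IsMaximallyEntangled.isSeparable_isotropic [DecidableEq X] [DecidableEq Y]
    {Ψ : QInfoStructure X Y} (h : Ψ.IsMaximallyEntangled) {p : ℝ} (hp : p ∈ Set.Icc (0 : ℝ) 1)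
    (hp' : p ≤ 1 / (Fintype.card Y + 1)) : (Ψ.isotropic p hp).IsSeparable := by
  obtain ⟨hcard, E, F, -, hE', -, hF', hΨ⟩ := h.exists_unitary
  obtain ⟨-, y⟩ := Ψ.isDensityMatrix.nonempty
  have : Nonempty Y := ⟨y⟩
  have hsum := sum_addChar_kronecker Y
  have hN : 0 < (Fintype.card (Y → ZMod 3) : ℝ) := by exact_mod_cast Fintype.card_pos
  generalize Fintype.card (Y → ZMod 3) = N at hsum hN
  have hd : 0 < (Fintype.card Y : ℝ) := by exact_mod_cast Fintype.card_pos
  set d := Fintype.card Y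
  have hN0 : (N : ℂ) ≠ 0 := by exact_mod_cast hN.ne'
  have hd0 : (d : ℂ) ≠ 0 := by exact_mod_cast hd.ne'
  set Ω : Y × Y → ℂ := fun p => if p.1 = p.2 then 1 else 0 with hΩ
  let G := E ⊗ₖ F
  have hG : G * Gᴴ = 1 := by
    rw [conjTranspose_kronecker, ← mul_kronecker_mul, hE', hF', one_kronecker_one]
  have hGΩ : G * vecMulVec Ω Ω * Gᴴ = vecMulVec (fun p : X × Y => (E * Fᵀ) p.1 p.2)
        (star fun p : X × Y => (E * Fᵀ) p.1 p.2) := by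
    have h1 : G *ᵥ Ω = fun p : X × Y => (E * Fᵀ) p.1 p.2 := by
      ext ⟨x, y⟩
      simp [G, hΩ, mulVec, dotProduct, Fintype.sum_prod_type, Matrix.mul_apply]
    have h2 : star Ω = Ω := by
      ext p
      simp [hΩ, apply_ite star]
    rw [mul_vecMulVec, vecMulVec_mul, h1, ← h1, star_mulVec, h2]
  -- The character identity yields `(p/d) (1 + |Ω⟩⟨Ω|)`; `c` is the remaining weight of the
  -- identity, nonnegative exactly when `p (d + 1) ≤ 1`.
  let a : ℝ := p / (d * N)
  let b : ℝ := p / d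
  let c : ℝ := (1 - p) / (d * d) - p / d
  have ha : 0 ≤ a := div_nonneg hp.1 (by positivity)
  have hb : 0 ≤ b := div_nonneg hp.1 (by positivity)
  have hc : 0 ≤ c := by
    have h1 : p * (d + 1) ≤ 1 := by rwa [le_div_iff₀ (by positivity)] at hp'
    have h2 : c = (1 - p * (d + 1)) / (d * d) := by
      simp only [c]
      field_simp
      ring
    rw [h2]
    exact div_nonneg (by linarith) (by positivity)
  have hstate : (Ψ.isotropic p hp).state = a • (G * ((N : ℂ) • (1 + vecMulVec Ω Ω)) * Gᴴ) + c • 1 := by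
    rw [Matrix.mul_smul, Matrix.smul_mul, Matrix.mul_add, Matrix.add_mul, Matrix.mul_one, hG, hGΩ]
    simp only [isotropic, hΨ, hcard]
    ext i j
    simp only [Matrix.add_apply, Matrix.smul_apply, smul_eq_mul, Complex.real_smul, a, c]
    push_cast
    field_simp
    ring
  let S : AddChar (Y → ZMod 3) ℂ ⊕ Y ⊕ Unit → Matrix X X ℂ :=
    Sum.elim (fun ψ => a • (E * vecMulVec (fun k => ψ (Pi.single k 1))
        (star fun k => ψ (Pi.single k 1)) * Eᴴ))
      (Sum.elim (fun k => b • (E * Matrix.single k k (1 : ℂ) * Eᴴ)) fun _ => c • 1)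
  let T : AddChar (Y → ZMod 3) ℂ ⊕ Y ⊕ Unit → Matrix Y Y ℂ :=
    Sum.elim (fun ψ => F * vecMulVec (star fun k => ψ (Pi.single k 1))
        (fun k => ψ (Pi.single k 1)) * Fᴴ)
      (Sum.elim (fun k => F * Matrix.single k k (1 : ℂ) * Fᴴ) fun _ => 1)
  have hsingle : ∀ k : Y, (Matrix.single k k (1 : ℂ)).PosSemidef := fun k => by
    rw [← diagonal_single]
    refine PosSemidef.diagonal fun i => ?_
    by_cases hi : i = k <;> simp [hi]
  refine isSeparable_of_sum _ S T ?_ ?_ ?_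
  · rintro (ψ | k | _)
    · exact ((posSemidef_vecMulVec_self_star _).mul_mul_conjTranspose_same E).smul ha
    · exact ((hsingle k).mul_mul_conjTranspose_same E).smul hb
    · exact PosSemidef.one.smul hc
  · rintro (ψ | k | _)
    · exact (posSemidef_vecMulVec_star_self _).mul_mul_conjTranspose_same F
    · exact (hsingle k).mul_mul_conjTranspose_same F
    · exact PosSemidef.one
  · have hconj : ∀ (M M' : Matrix Y Y ℂ), (E * M * Eᴴ) ⊗ₖ (F * M' * Fᴴ) = G * (M ⊗ₖ M') * Gᴴ :=
      fun M M' => by rw [mul_kronecker_mul, mul_kronecker_mul, conjTranspose_kronecker]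
    have hab : a * N = b := by
      simp only [a, b]
      field_simp
    rw [hstate, ← hsum, Fintype.sum_sum_type, Fintype.sum_sum_type]
    simp only [S, T, Sum.elim_inl, Sum.elim_inr, smul_kronecker, hconj, one_kronecker_one,
      Finset.univ_unique, Finset.sum_singleton]
    rw [← Finset.smul_sum, ← Finset.smul_sum, ← Matrix.sum_mul, ← Matrix.sum_mul,
      ← Matrix.mul_sum, ← Matrix.mul_sum, Matrix.mul_add, Matrix.add_mul, smul_add, add_assoc,
      Matrix.mul_smul, Matrix.smul_mul, ← hab, mul_smul, Nat.cast_smul_eq_nsmul,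
      Nat.cast_smul_eq_nsmul]

/-! ### Existence of the auxiliary state and the equivalence -/

theorem exists_isMaximallyEntangled (B : Type u) [Fintype B] [Nonempty B] :
    ∃ Ψ : QInfoStructure B B, Ψ.IsMaximallyEntangled := by
  classical
  let r : ℝ := (Real.sqrt (Fintype.card B))⁻¹
  let ψ : B × B → ℂ := fun p => r * ∑ k, EuclideanSpace.basisFun B ℂ k p.1 *
    EuclideanSpace.basisFun B ℂ k p.2
  have hr : (r : ℂ) * r = (Fintype.card B : ℂ)⁻¹ := by
    rw [← Complex.ofReal_mul, ← mul_inv, Real.mul_self_sqrt (Nat.cast_nonneg _)]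
    push_cast
    rfl
  refine ⟨⟨vecMulVec ψ (star ψ), posSemidef_vecMulVec_self_star ψ, ?_⟩,
    EuclideanSpace.basisFun B ℂ, EuclideanSpace.basisFun B ℂ, ψ, fun x y => rfl, rfl⟩
  have h1 : ∀ x y, ψ (x, y) = if x = y then (r : ℂ) else 0 := fun x y => by
    simp [ψ]
  have h2 : ∀ x y, ψ (x, y) * star (ψ (x, y)) = if x = y then (Fintype.card B : ℂ)⁻¹ else 0 :=
    fun x y => by
      rw [h1]
      split_ifs
      · rw [RCLike.star_def, Complex.conj_ofReal, hr]
      · simp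
  rw [trace_vecMulVec, dotProduct]
  simp only [Fintype.sum_prod_type, Pi.star_apply, h2]
  simp

theorem isotropic_one [DecidableEq X] [DecidableEq Y] (Ψ : QInfoStructure X Y)
    (h : (1 : ℝ) ∈ Set.Icc (0 : ℝ) 1) : Ψ.isotropic 1 h = Ψ := by
  cases Ψ
  simp [isotropic]

end QInfoStructure

theorem mainTheorem3 {A B B' : Type u} [Fintype A] [Fintype B] [Fintype B']
    [DecidableEq B] [DecidableEq B']
    (ρ : QInfoStructure A B) (σ : QInfoStructure A B') :
    List.TFAE
      [ρ.Sufficient σ,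
       ∀ (X Y : Type u) [Fintype X] [Fintype Y] [DecidableEq X] [DecidableEq Y]
          (ω : QInfoStructure X Y), (ω.comp ρ).MoreInformative (ω.comp σ),
       ∃ (X Y : Type u) (_ : Fintype X) (_ : Fintype Y) (_ : DecidableEq X) (_ : DecidableEq Y)
          (ω : QInfoStructure X Y), Fintype.card X = Fintype.card B' ∧
          Fintype.card Y = Fintype.card B' ∧ ω.IsMaximallyEntangled ∧
          (ω.comp ρ).MoreInformative (ω.comp σ),
       ∃ (X Y : Type u) (_ : Fintype X) (_ : Fintype Y) (_ : DecidableEq X) (_ : DecidableEq Y)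
          (ω : QInfoStructure X Y), Fintype.card Y = Fintype.card B' ∧ ω.IsComplete ∧
          (ω.comp ρ).MoreInformative (ω.comp σ)] ∧
    ∀ (X Y : Type u) [Fintype X] [Fintype Y] [DecidableEq X] [DecidableEq Y]
      (Ψ : QInfoStructure X Y), Ψ.IsMaximallyEntangled →
      ∀ (p : ℝ) (hp : p ∈ Set.Icc (0 : ℝ) 1),
        (p ≠ 0 → (Ψ.isotropic p hp).IsComplete) ∧
        (p ≤ 1 / (Fintype.card Y + 1) → (Ψ.isotropic p hp).IsSeparable) := by
  obtain ⟨-, b'⟩ := σ.isDensityMatrix.nonempty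
  have : Nonempty B' := ⟨b'⟩
  refine ⟨?_, fun X Y _ _ _ _ Ψ hΨ p hp =>
    ⟨hΨ.isComplete_isotropic hp, hΨ.isSeparable_isotropic hp⟩⟩
  tfae_have 1 → 2 := fun h X Y _ _ _ _ ω => h.comp_moreInformative ω
  tfae_have 2 → 3 := fun h => by
    obtain ⟨Ψ, hΨ⟩ := QInfoStructure.exists_isMaximallyEntangled B'
    exact ⟨B', B', inferInstance, inferInstance, inferInstance, inferInstance, Ψ, rfl, rfl, hΨ,
      h B' B' Ψ⟩
  tfae_have 3 → 4 := by
    rintro ⟨X, Y, _, _, _, _, Ψ, -, hY, hΨ, h⟩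
    have hc := hΨ.isComplete_isotropic (p := 1) (by simp) one_ne_zero
    rw [QInfoStructure.isotropic_one] at hc
    exact ⟨X, Y, _, _, inferInstance, inferInstance, Ψ, hY, hc, h⟩
  tfae_have 4 → 1 := by
    rintro ⟨X, Y, _, _, _, _, ω, hY, hω, h⟩
    exact QInfoStructure.sufficient_of_comp_moreInformative hY
      (QInfoStructure.span_rightBlock_eq_top hω.1) h
  tfae_finish
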